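/- Let $K$ be a finite field of characteristic $p$ whose cardinality is not a prime number and is greater than $4$, and let $K(x)$ be the rational function field over $K$. Then for every integer $m \ge 1$ there exists a finite separable extension $E/K(x)$ of degree $[E:K(x)] = p^m$, with full constant field $K$, such that 1. $E/K(x)$ is wildly ramified, i.e. there are a place $P$ of $K(x)$ and a place $Q$ of $E$ lying over $P$ whose ramification index $e(Q|P)$ is greater than $1$ and divisible by $p$; 2. every rational place of $K(x)$ (that is, every place of degree one: the zeros $P_\alpha$ of $x-\alpha$ for $\alpha\in K$, and the pole $P_\infty$ of $x$) splits completely in $E$, i.e. has exactly $[E:K(x)]$ distinct places of $E$ lying over it. -/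

import Mathlib

universe u

/-- A place of a function field `F` with constant field `k`, given by its valuation ring: a proper
valuation subring of `F` that contains the constants `k`. -/
@[ext]
structure Place (k F : Type*) [Field k] [Field F] [Algebra k F] where
  /-- The valuation ring of the place. -/
  ring : ValuationSubring F
  algebraMap_mem : ∀ a : k, algebraMap k F a ∈ ring
  ne_top : ring ≠ ⊤

namespace Place

variable {k F E : Type*} [Field k] [Field F] [Algebra k F] [Field E] [Algebra k E] [Algebra F E]

/-- The valuation ring of a place is an algebra over the constant field, by the inclusion. -/
noncomputable instance (P : Place k F) : Algebra k P.ring :=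
  ((algebraMap k F).codRestrict P.ring.toSubring P.algebraMap_mem).toAlgebra

/-- The degree of a place: the degree over `k` of its residue field. -/
noncomputable def degree (P : Place k F) : ℕ :=
  Module.finrank k (IsLocalRing.ResidueField P.ring)

/-- Rational places are the places of degree one. -/
def IsRational (P : Place k F) : Prop :=
  P.degree = 1

/-- The place `Q` of the extension `E` lies over the place `P` of `F`: the valuation ring of `P` is
the intersection of the valuation ring of `Q` with `F`. -/
def LiesOver (Q : Place k E) (P : Place k F) : Prop :=
  Q.ring.comap (algebraMap F E) = P.ring

/-- The inclusion of valuation rings for a place `Q` lying over `P`. -/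
def LiesOver.ringHom {Q : Place k E} {P : Place k F} (h : Q.LiesOver P) : P.ring →+* Q.ring :=
  ((algebraMap F E).comp P.ring.subtype).codRestrict Q.ring.toSubring fun x =>
    show (x : F) ∈ Q.ring.comap (algebraMap F E) by rw [show _ = P.ring from h]; exact x.2

/-- The ramification index `e(Q|P)`: the exponent `e` for which the maximal ideal of `P` generates
the `e`-th power of the maximal ideal of `Q`. -/
noncomputable def LiesOver.ramificationIdx {Q : Place k E} {P : Place k F} (h : Q.LiesOver P) : ℕ :=
  letI : Algebra P.ring Q.ring := h.ringHom.toAlgebra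
  Ideal.ramificationIdx' (IsLocalRing.maximalIdeal P.ring) (IsLocalRing.maximalIdeal Q.ring)

/-- `Q|P` is wildly ramified: `e(Q|P) > 1` and the characteristic of `k` divides `e(Q|P)`. -/
def LiesOver.IsWildlyRamified {Q : Place k E} {P : Place k F} (h : Q.LiesOver P) : Prop :=
  1 < h.ramificationIdx ∧ ringChar k ∣ h.ramificationIdx

/-- The place `P` of `F` splits completely in the finite extension `E / F`: there are exactly
`[E : F]` places of `E` lying over `P`. -/
def SplitsCompletely (P : Place k F) (E : Type*) [Field E] [Algebra k E] [Algebra F E] : Prop :=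
  {Q : Place k E | Q.LiesOver P}.ncard = Module.finrank F E

end Place

/-- The extension `E / F` of function fields over `k` is wildly ramified: some place of `E` is
wildly ramified over the place of `F` below it. -/
def IsWildlyRamifiedExtension (k F E : Type*) [Field k] [Field F] [Algebra k F] [Field E]
    [Algebra k E] [Algebra F E] : Prop :=
  ∃ (P : Place k F) (Q : Place k E) (h : Q.LiesOver P), h.IsWildlyRamified

/-- `k` is the full constant field of `F`: every element of `F` algebraic over `k` lies in `k`. -/
def IsFullConstantField (k F : Type*) [Field k] [Field F] [Algebra k F] : Prop :=
  ∀ z : F, IsAlgebraic k z → z ∈ (algebraMap k F).range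

open Polynomial

/-! Write `q` for the cardinality of `K`, `s = X ^ q - X` and `D = s ^ (p * m + 1) + 1`. The field
`E` is generated by roots `y i` of `T ^ p - T = f i`, where `f i = X ^ i * s / D` for `i < m`.

Degree: `D` is squarefree, so a nontrivial `𝔽_p`-combination of the `f i`, being a proper fraction
with denominator `D`, cannot equal `w ^ p - w`, whose poles have order divisible by `p`.
Artin–Schreier theory then gives the Galois group `(ZMod p) ^ m`
(`ArtinSchreierIndependent.isArtinSchreierExtension`).

Splitting: every `f i` vanishes at every rational place, since `s` vanishes at the finite ones and
`f i` has negative degree. Above such a place `y i ^ p - y i` has residue `0`, so the `y i` have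
residues in `𝔽_p`. The Galois group translates these residue vectors simply transitively, and a
vector determines its place (`le_of_hasResidues`); hence there are `p ^ m` places.

Constants: at such a place a constant of `E` is congruent to an element of `K(x)`, hence to one of
`K`, and congruent constants are equal.

Wild ramification: `f 0 = s / D` has simple poles at the zeros of `D`, and a simple pole of `y ^ p -
y` below forces `p` to divide the ramification index above. -/

theorem separable_artinSchreier (p : ℕ) {F : Type*} [Field F] [CharP F p] (f : F) :
    (X ^ p - X - C f : F[X]).Separable := by
  refine ⟨0, -1, ?_⟩
  simp [derivative_X_pow]

/-! ### Elementary abelian Artin–Schreier extensions -/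

section ArtinSchreier

variable (p : ℕ) [hp : Fact p.Prime]

/-- The embedding of the prime field `ZMod p` into a ring of characteristic `p`. -/
noncomputable abbrev primeFieldHom (F : Type*) [Ring F] [CharP F p] : ZMod p →+* F :=
  ZMod.castHom dvd_rfl F

/-- Artin–Schreier factorization: `y ^ p - y` is the product of the translates of `y` by the
elements of the prime field. -/
theorem prod_sub_primeFieldHom {F : Type*} [Field F] [CharP F p] (y : F) :
    ∏ c : ZMod p, (y - primeFieldHom p F c) = y ^ p - y := by
  have hroots : (X ^ p - X : (ZMod p)[X]).roots = Finset.univ.val := by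
    have := FiniteField.roots_X_pow_card_sub_X (ZMod p)
    rwa [ZMod.card] at this
  have hmonic : (X ^ p - X : (ZMod p)[X]).Monic :=
    monic_X_pow_sub (by rw [degree_X]; exact_mod_cast hp.out.one_lt)
  have h := prod_multiset_X_sub_C_of_monic_of_roots_card_eq hmonic (by
    rw [hroots, FiniteField.X_pow_card_sub_X_natDegree_eq _ hp.out.one_lt]
    simp [ZMod.card])
  rw [hroots] at h
  have h2 := congrArg (eval₂ (primeFieldHom p F) y) h
  change eval₂ _ _ (∏ c : ZMod p, (X - C c)) = _ at h2
  rw [eval₂_finsetProd] at h2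
  simpa using h2

theorem exists_primeFieldHom_eq {F : Type*} [Field F] [CharP F p] {x : F} (hx : x ^ p = x) :
    ∃ c : ZMod p, x = primeFieldHom p F c := by
  have h := prod_sub_primeFieldHom p x
  rw [hx, sub_self, Finset.prod_eq_zero_iff] at h
  obtain ⟨c, -, hc⟩ := h
  exact ⟨c, sub_eq_zero.mp hc⟩

theorem primeFieldHom_pow {F : Type*} [Field F] [CharP F p] (c : ZMod p) :
    primeFieldHom p F c ^ p = primeFieldHom p F c := by
  rw [← map_pow, ZMod.pow_card]

theorem map_primeFieldHom {R S : Type*} [Ring R] [CharP R p] [Ring S] [CharP S p]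
    (f : R →+* S) (c : ZMod p) : f (primeFieldHom p R c) = primeFieldHom p S c :=
  DFunLike.congr_fun (Subsingleton.elim (f.comp (primeFieldHom p R)) (primeFieldHom p S)) c

/-- `f` is independent modulo Artin–Schreier elements: no nontrivial `𝔽_p`-combination of the `f i`
has the form `w ^ p - w`. -/
def ArtinSchreierIndependent {F ι : Type*} [Field F] [CharP F p] [Fintype ι] (f : ι → F) : Prop :=
  ∀ (a : ι → ZMod p) (w : F), w ^ p - w = ∑ i, primeFieldHom p F (a i) * f i → a = 0

/-- An elementary abelian Artin–Schreier extension: `E / F` is finite Galois, and translating the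
roots `y i` of `T ^ p - T - f i` identifies the Galois group with `(ZMod p) ^ ι`. -/
structure IsArtinSchreierExtension {F E ι : Type*} [Field F] [CharP F p] [Field E] [CharP E p]
    [Algebra F E] (f : ι → F) (y : ι → E) : Prop where
  finite : FiniteDimensional F E
  galois : IsGalois F E
  root : ∀ i, y i ^ p - y i = algebraMap F E (f i)
  exists_smul : ∀ c : ι → ZMod p, ∃ σ : E ≃ₐ[F] E, ∀ i, σ (y i) = y i + primeFieldHom p E (c i)
  eq_one : ∀ σ : E ≃ₐ[F] E, (∀ i, σ (y i) = y i) → σ = 1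

theorem exists_map_eq_add {F E : Type*} [Field F] [Field E] [CharP E p]
    [Algebra F E] {f : F} {y z : E} (hy : y ^ p - y = algebraMap F E f)
    (hz : z ^ p - z = algebraMap F E f) :
    ∃ c : ZMod p, z = y + primeFieldHom p E c := by
  obtain ⟨c, hc⟩ := exists_primeFieldHom_eq p (x := z - y) (by
    rw [sub_pow_char]; linear_combination hz - hy)
  exact ⟨c, by rw [← hc]; ring⟩

theorem IsArtinSchreierExtension.finrank_eq {F E : Type*} {m : ℕ} [Field F] [CharP F p] [Field E]
    [CharP E p] [Algebra F E] {f : Fin m → F} {y : Fin m → E}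
    (h : IsArtinSchreierExtension p f y) : Module.finrank F E = p ^ m := by
  have := h.finite
  have := h.galois
  choose τ hτ using h.exists_smul
  have hbij : Function.Bijective τ := by
    refine ⟨fun c d hcd => funext fun i => (primeFieldHom p E).injective ?_, fun σ => ?_⟩
    · have h1 := hτ c i
      rw [hcd, hτ d i] at h1
      exact (add_left_cancel h1).symm
    · have (i : Fin m) : ∃ c : ZMod p, σ (y i) = y i + primeFieldHom p E c :=
        exists_map_eq_add p (h.root i) (by
          rw [← map_pow, ← map_sub, h.root i, AlgEquiv.commutes])
      choose c hc using this
      refine ⟨c, ?_⟩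
      have := h.eq_one (σ⁻¹ * τ c) fun i => by
        rw [AlgEquiv.mul_apply, hτ c i, ← hc i, ← AlgEquiv.mul_apply, inv_mul_cancel]
        rfl
      rw [inv_mul_eq_one] at this
      exact this.symm
  rw [← IsGalois.card_aut_eq_finrank, ← Nat.card_congr (Equiv.ofBijective τ hbij)]
  simp [Nat.card_eq_fintype_card, ZMod.card]

/-- The translations `δ σ` form a subgroup of `(ZMod p) ^ m`. Were it proper, a nonzero functional
`a` would kill it, so `∑ a i * y i` would be Galois-invariant, hence some `w` in `F` with `w ^ p - w
= ∑ a i * f i`, against independence. -/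
theorem ArtinSchreierIndependent.isArtinSchreierExtension {F E : Type*} {m : ℕ} [Field F]
    [CharP F p] [Field E] [CharP E p] [Algebra F E] [FiniteDimensional F E] [IsGalois F E]
    {f : Fin m → F} (hf : ArtinSchreierIndependent p f) {y : Fin m → E}
    (hy : ∀ i, y i ^ p - y i = algebraMap F E (f i))
    (hone : ∀ σ : E ≃ₐ[F] E, (∀ i, σ (y i) = y i) → σ = 1) :
    IsArtinSchreierExtension p f y := by
  have hex (σ : E ≃ₐ[F] E) (i : Fin m) : ∃ c : ZMod p, σ (y i) = y i + primeFieldHom p E c :=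
    exists_map_eq_add p (hy i) (by rw [← map_pow, ← map_sub, hy i, AlgEquiv.commutes])
  choose δ hδ using hex
  have hZ (σ : E ≃ₐ[F] E) (c : ZMod p) : σ (primeFieldHom p E c) = primeFieldHom p E c :=
    map_primeFieldHom p (σ : E →+* E) c
  have hinj := (primeFieldHom p E).injective
  have hmul (σ τ : E ≃ₐ[F] E) : δ (σ * τ) = δ σ + δ τ := by
    funext i
    apply hinj
    have h1 := hδ (σ * τ) i
    rw [AlgEquiv.mul_apply, hδ τ i, map_add, hδ σ i, hZ] at h1
    rw [Pi.add_apply, map_add]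
    linear_combination -h1
  let Δ : Additive (E ≃ₐ[F] E) →+ (Fin m → ZMod p) := AddMonoidHom.mk' (fun σ => δ σ.toMul)
    fun σ τ => hmul σ.toMul τ.toMul
  let H : Submodule (ZMod p) (Fin m → ZMod p) := AddSubgroup.toZModSubmodule p Δ.range
  have hH : H = ⊤ := by
    by_contra hne
    obtain ⟨φ, hφ, hle⟩ := Submodule.exists_le_ker_of_lt_top H (lt_top_iff_ne_top.mpr hne)
    let a : Fin m → ZMod p := fun i => φ (Pi.single i 1)
    have hφa (c : Fin m → ZMod p) : φ c = ∑ i, c i * a i := by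
      conv_lhs => rw [pi_eq_sum_univ' c]
      simp [a, map_sum]
    have hfix (σ : E ≃ₐ[F] E) : σ (∑ i, primeFieldHom p E (a i) * y i)
        = ∑ i, primeFieldHom p E (a i) * y i := by
      have h0 : φ (δ σ) = 0 := hle (show δ σ ∈ H from ⟨Additive.ofMul σ, rfl⟩)
      have h1 : ∑ i, primeFieldHom p E (a i) * primeFieldHom p E (δ σ i) = 0 := by
        rw [← map_zero (primeFieldHom p E), ← h0, hφa, map_sum]
        exact Finset.sum_congr rfl fun i _ => by rw [map_mul, mul_comm]
      simp only [map_sum, map_mul, hZ, hδ, mul_add, Finset.sum_add_distrib, h1, add_zero]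
    obtain ⟨w, hw⟩ := (IsGalois.mem_range_algebraMap_iff_fixed _).mpr hfix
    refine hφ (LinearMap.ext fun c => ?_)
    have ha : a = 0 := hf a w (by
      apply (algebraMap F E).injective
      rw [map_sub, map_pow, hw, map_sum, sum_pow_char, ← Finset.sum_sub_distrib]
      refine Finset.sum_congr rfl fun i _ => ?_
      rw [mul_pow, primeFieldHom_pow, map_mul, map_primeFieldHom, ← hy i]
      ring)
    rw [hφa, ha]
    simp
  refine ⟨inferInstance, inferInstance, hy, fun c => ?_, hone⟩
  obtain ⟨σ, hσ⟩ : c ∈ H := hH ▸ Submodule.mem_top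
  exact ⟨σ.toMul, fun i => by rw [hδ, ← hσ]; rfl⟩

theorem ArtinSchreierIndependent.injective {F : Type*} {m : ℕ} [Field F] [CharP F p]
    {f : Fin m → F} (hf : ArtinSchreierIndependent p f) : Function.Injective f := by
  intro i j hij
  by_contra hne
  have h := hf (Pi.single i 1 - Pi.single j 1) 0 (by
    simp only [Pi.sub_apply, map_sub, sub_mul, Finset.sum_sub_distrib]
    rw [Finset.sum_eq_single i (fun k _ hk => by simp [hk]) (by simp),
      Finset.sum_eq_single j (fun k _ hk => by simp [hk]) (by simp)]
    simp [hij, hp.out.ne_zero])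
  have := congrFun h i
  simp [hne] at this

/-- The splitting field of `∏ (T ^ p - T - f i)` is an elementary abelian Artin–Schreier extension
when the `f i` are independent. -/
theorem ArtinSchreierIndependent.exists_isArtinSchreierExtension {F : Type*} {m : ℕ} [Field F]
    [CharP F p] {f : Fin m → F} (hf : ArtinSchreierIndependent p f)
    (E : Type*) [Field E] [CharP E p] [Algebra F E]
    [IsSplittingField F E (∏ i, (X ^ p - X - C (f i)))] :
    ∃ y : Fin m → E, IsArtinSchreierExtension p f y := by
  have hsep : (∏ i, (X ^ p - X - C (f i))).Separable := by
    refine separable_prod (fun i j hij => ?_) fun i => separable_artinSchreier p _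
    have hne : f j - f i ≠ 0 := sub_ne_zero.mpr fun h => hij (hf.injective p h).symm
    refine ⟨C (f j - f i)⁻¹, -C (f j - f i)⁻¹, ?_⟩
    have : C (f j - f i)⁻¹ * C (f j - f i) = (1 : F[X]) := by
      rw [← C_mul, inv_mul_cancel₀ hne, C_1]
    rw [← this, C_sub]
    ring
  have := IsSplittingField.finiteDimensional E (∏ i, (X ^ p - X - C (f i)))
  have : IsGalois F E := IsGalois.of_separable_splitting_field hsep
  have hsplit := IsSplittingField.splits E (∏ i, (X ^ p - X - C (f i)))
  have hne : (∏ i, (X ^ p - X - C (f i))) ≠ 0 := hsep.ne_zero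
  have hroot (i : Fin m) : ∃ y : E, y ^ p - y = algebraMap F E (f i) := by
    have h1 : ((X ^ p - X - C (f i)).map (algebraMap F E)).Splits :=
      hsplit.of_dvd (map_ne_zero hne) (Polynomial.map_dvd (algebraMap F E)
        (Finset.dvd_prod_of_mem (fun i => X ^ p - X - C (f i)) (Finset.mem_univ i)))
    have hdeg : (X ^ p - X - C (f i) : F[X]).degree = p := by
      rw [sub_sub, degree_sub_eq_left_of_degree_lt]
      · exact degree_X_pow p
      · rw [degree_X_pow, degree_X_add_C]
        exact_mod_cast hp.out.one_lt
    obtain ⟨y, hy⟩ := h1.exists_eval_eq_zero (by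
      rw [degree_map, hdeg]
      exact_mod_cast hp.out.ne_zero)
    refine ⟨y, ?_⟩
    rw [eval_map] at hy
    simpa [sub_eq_zero] using hy
  choose y hy using hroot
  refine ⟨y, hf.isArtinSchreierExtension p hy fun σ hσ => ?_⟩
  have hZ (c : ZMod p) : σ (primeFieldHom p E c) = primeFieldHom p E c :=
    map_primeFieldHom p (σ : E →+* E) c
  have : (σ : E →ₐ[F] E) = AlgHom.id F E := by
    refine AlgHom.ext_of_adjoin_eq_top
      (IsSplittingField.adjoin_rootSet E (∏ i, (X ^ p - X - C (f i)))) fun z hz => ?_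
    rw [mem_rootSet, map_prod, Finset.prod_eq_zero_iff] at hz
    obtain ⟨i, -, hi⟩ := hz.2
    obtain ⟨c, rfl⟩ := exists_map_eq_add p (hy i) (z := z) (by
      simpa [sub_eq_zero] using hi)
    change σ _ = _
    rw [map_add, hσ i, hZ]
    rfl
  exact AlgEquiv.ext fun z => DFunLike.congr_fun this z

end ArtinSchreier

/-! ### Extension of valuation rings, and geometric sums -/

namespace ValuationSubring

variable {F E : Type*} [Field F] [Field E] [Algebra F E]

theorem valuation_algebraMap_lt_one_iff {V : ValuationSubring F} {W : ValuationSubring E}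
    (h : W.comap (algebraMap F E) = V) (x : F) :
    W.valuation (algebraMap F E x) < 1 ↔ V.valuation x < 1 := by
  rw [← mem_nonunits_iff, ← mem_nonunits_iff, mem_nonunits_iff_or, mem_nonunits_iff_or, ← h,
    mem_comap, map_inv₀, map_eq_zero]

/-- Chevalley's theorem: some valuation ring of `E` dominates the local ring `V`, and domination
prevents its trace on `F` from being larger than `V`. -/
theorem exists_comap_eq (V : ValuationSubring F) :
    ∃ W : ValuationSubring E, W.comap (algebraMap F E) = V := by
  obtain ⟨W, hW, hloc⟩ :=
    IsLocalRing.exists_factor_valuationRing ((algebraMap F E).comp V.subtype)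
  refine ⟨W, le_antisymm (fun x hx => ?_) fun x hx => hW ⟨x, hx⟩⟩
  by_contra hxV
  have hx' : x⁻¹ ∈ V := (V.mem_or_inv_mem x).resolve_left hxV
  have hx0 : x ≠ 0 := fun h => hxV (h ▸ V.zero_mem)
  have hu : IsUnit (⟨x⁻¹, hx'⟩ : V) := by
    refine hloc.map_nonunit _ (IsUnit.of_mul_eq_one ⟨algebraMap F E x, hx⟩ ?_)
    apply Subtype.ext
    change algebraMap F E x⁻¹ * algebraMap F E x = 1
    rw [← map_mul, inv_mul_cancel₀ hx0, map_one]
  obtain ⟨w, hw⟩ := hu.exists_right_inv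
  have hw' : x⁻¹ * (w : F) = 1 := congrArg Subtype.val hw
  rw [inv_mul_eq_one₀ hx0] at hw'
  exact hxV (hw' ▸ w.2)

/-- The geometric sum `1 + z + ⋯ + z ^ (k - 1)` is a unit of `A` if `z ∈ A`, and has a pole
otherwise, for every large prime `k`. -/
theorem eventually_valuation_geom_sum (A : ValuationSubring E) (z : E) :
    ∀ᶠ k in Filter.atTop, k.Prime →
      1 ≤ A.valuation (∑ j ∈ Finset.range k, z ^ j) ∧
      (A.valuation (∑ j ∈ Finset.range k, z ^ j) = 1 ↔ z ∈ A) := by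
  by_cases hz : z ∈ A
  · let r : IsLocalRing.ResidueField A := IsLocalRing.residue A ⟨z, hz⟩
    -- If the sum had residue `0`, the prime `k` would be the residue characteristic (when `r = 1`)
    -- or the order of `r` (when `r ≠ 1`).
    filter_upwards [Filter.eventually_gt_atTop (orderOf r),
      Filter.eventually_gt_atTop (ringChar (IsLocalRing.ResidueField A))] with k hk1 hk2 hk
    suffices h : A.valuation (∑ j ∈ Finset.range k, z ^ j) = 1 from ⟨h.ge, by simp [h, hz]⟩
    let g : A := ∑ j ∈ Finset.range k, (⟨z, hz⟩ : A) ^ j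
    have hg : (g : E) = ∑ j ∈ Finset.range k, z ^ j := by
      change A.subtype g = _
      rw [map_sum]
      rfl
    rw [← hg, ← valuation_eq_one_iff]
    by_contra hu
    have h0 : ∑ j ∈ Finset.range k, r ^ j = 0 := by
      rw [← (IsLocalRing.residue_eq_zero_iff g).mpr ((IsLocalRing.mem_maximalIdeal g).mpr hu),
        map_sum]
      simp only [map_pow, r]
    by_cases hr : r = 1
    · rw [hr] at h0
      simp only [one_pow, Finset.sum_const, Finset.card_range, nsmul_eq_mul, mul_one] at h0
      rcases (Nat.dvd_prime hk).mp (ringChar.dvd h0) with h | h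
      · have := CharP.ringChar_ne_one (R := IsLocalRing.ResidueField A)
        exact this h
      · exact hk2.ne h
    · have h1 : r ^ k = 1 := by
        have := mul_geom_sum r k
        rw [h0, mul_zero] at this
        exact (sub_eq_zero.mp this.symm)
      rcases (Nat.dvd_prime hk).mp (orderOf_dvd_of_pow_eq_one h1) with h | h
      · exact hr (orderOf_eq_one_iff.mp h)
      · exact hk1.ne h
  · filter_upwards with k hk
    have hv : 1 < A.valuation z := by
      rwa [← not_le, valuation_le_one_iff]
    suffices h : 1 < A.valuation (∑ j ∈ Finset.range k, z ^ j) from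
      ⟨h.le, by simp [h.ne', hz]⟩
    obtain ⟨l, rfl⟩ : ∃ l, k = l + 1 := ⟨k - 1, (Nat.succ_pred_eq_of_pos hk.pos).symm⟩
    have hl : l ≠ 0 := by
      rintro rfl
      exact Nat.not_prime_one hk
    have h1 (n : ℕ) (hn : n ≠ 0) : A.valuation (z ^ n - 1) = A.valuation z ^ n := by
      rw [Valuation.map_sub_eq_of_lt_left, map_pow]
      rw [map_one, map_pow]
      exact one_lt_pow₀ hv hn
    have h2 := congrArg A.valuation (mul_geom_sum z (l + 1))
    rw [map_mul, h1 _ l.succ_ne_zero, show z - 1 = z ^ 1 - 1 by rw [pow_one],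
      h1 1 one_ne_zero, pow_one, pow_succ' (A.valuation z) l] at h2
    rw [mul_left_cancel₀ (zero_lt_one.trans hv).ne' h2]
    exact one_lt_pow₀ hv hl

end ValuationSubring

/-! ### Residue vectors and complete splitting -/

section Splitting

variable (p : ℕ) [hp : Fact p.Prime] {F E : Type*} [Field F] [CharP F p] [Field E] [CharP E p]
  [Algebra F E] {m : ℕ}

theorem valuation_primeFieldHom {Γ : Type*} [LinearOrderedCommGroupWithZero Γ]
    (v : Valuation E Γ) {c : ZMod p} (hc : c ≠ 0) : v (primeFieldHom p E c) = 1 := by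
  have h : v (primeFieldHom p E c) ^ (p - 1) = 1 := by
    rw [← map_pow, ← map_pow, ZMod.pow_card_sub_one_eq_one hc, map_one, map_one]
  exact (pow_eq_one_iff.mp h).resolve_right (Nat.sub_ne_zero_of_lt hp.out.one_lt)

theorem valuation_primeFieldHom_le {Γ : Type*} [LinearOrderedCommGroupWithZero Γ]
    (v : Valuation E Γ) (c : ZMod p) : v (primeFieldHom p E c) ≤ 1 := by
  by_cases hc : c = 0
  · rw [hc, map_zero, map_zero]
    exact zero_le_one
  · exact (valuation_primeFieldHom p v hc).le

/-- The elements `y i` have residues `c i` at the valuation `v`. -/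
def Valuation.HasResidues {Γ : Type*} [LinearOrderedCommGroupWithZero Γ]
    (v : Valuation E Γ) (y : Fin m → E) (c : Fin m → ZMod p) : Prop :=
  ∀ i, v (y i - primeFieldHom p E (c i)) < 1

variable {p}

theorem Valuation.map_pow_sub_pow_lt_one {R Γ : Type*} [CommRing R]
    [LinearOrderedCommGroupWithZero Γ] (v : Valuation R Γ) {a b : R} (ha : v a ≤ 1) (hb : v b ≤ 1)
    (hab : v (a - b) < 1) (n : ℕ) : v (a ^ n - b ^ n) < 1 := by
  induction n with
  | zero => simp
  | succ n ih =>
    rw [show a ^ (n + 1) - b ^ (n + 1) = a * (a ^ n - b ^ n) + (a - b) * b ^ n by ring]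
    refine v.map_add_lt ?_ ?_
    · rw [map_mul]
      exact mul_lt_one_of_nonneg_of_lt_one_right ha zero_le ih
    · rw [map_mul, map_pow]
      exact mul_lt_one_of_nonneg_of_lt_one_left zero_le hab (pow_le_one₀ zero_le hb)

section

variable {Γ : Type*} [LinearOrderedCommGroupWithZero Γ] {v : Valuation E Γ}

theorem Valuation.HasResidues.unique {y : Fin m → E} {c d : Fin m → ZMod p}
    (hc : v.HasResidues p y c) (hd : v.HasResidues p y d) : c = d := by
  funext i
  by_contra hne
  have h := v.map_sub_lt (hd i) (hc i)
  rw [sub_sub_sub_cancel_left, ← _root_.map_sub,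
    valuation_primeFieldHom p v (sub_ne_zero.mpr hne)] at h
  exact lt_irrefl _ h

/-- `y ^ p - y` is the product of the `y - c`, so these cannot all have valuation at least `1`. -/
theorem Valuation.exists_hasResidues {y : Fin m → E} (hy : ∀ i, v (y i ^ p - y i) < 1) :
    ∃ c, v.HasResidues p y c := by
  have (i : Fin m) : ∃ c, v (y i - primeFieldHom p E c) < 1 := by
    by_contra! hge
    refine (hy i).not_ge ?_
    rw [← prod_sub_primeFieldHom, map_prod]
    exact Finset.one_le_prod' fun c _ => hge c
  choose c hc using this
  exact ⟨c, hc⟩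

theorem Valuation.HasResidues.valuation_le {y : Fin m → E} {c : Fin m → ZMod p}
    (hc : v.HasResidues p y c) (i : Fin m) : v (y i) ≤ 1 := by
  rw [← sub_add_cancel (y i) (primeFieldHom p E (c i))]
  exact v.map_add_le (hc i).le (valuation_primeFieldHom_le p v _)

/-- A function that is `1` at the places where the `y i` have residues `c i`, and vanishes where
they have other residues in the prime field. -/
noncomputable def residueIndicator (p : ℕ) [Fact p.Prime] [CharP E p] (y : Fin m → E)
    (c : Fin m → ZMod p) : E :=
  ∏ i, (1 - (y i - primeFieldHom p E (c i)) ^ (p - 1))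

theorem Valuation.HasResidues.residueIndicator_sub_one {y : Fin m → E} {c : Fin m → ZMod p}
    (hc : v.HasResidues p y c) : v (residueIndicator p y c - 1) < 1 := by
  refine Finset.prod_induction _ (fun x => v (x - 1) < 1) (fun a b ha hb => ?_) (by simp)
    fun i _ => ?_
  · have ha' : v a ≤ 1 := by
      rw [← sub_add_cancel a 1]
      exact v.map_add_le ha.le v.map_one.le
    rw [show a * b - 1 = a * (b - 1) + (a - 1) by ring]
    refine v.map_add_lt ?_ ha
    rw [map_mul]
    exact mul_lt_one_of_nonneg_of_lt_one_right ha' zero_le hb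
  · rw [sub_sub_cancel_left, Valuation.map_neg, map_pow]
    exact pow_lt_one₀ zero_le (hc i) (Nat.sub_ne_zero_of_lt hp.out.one_lt)

/-- Where `d i ≠ c i`, the residue of `y i - d i` is a nonzero element of `𝔽_p`, whose power `p - 1`
is `1`; the `i`-th factor therefore vanishes. -/
theorem Valuation.HasResidues.residueIndicator_of_ne {y : Fin m → E} {c d : Fin m → ZMod p}
    (hc : v.HasResidues p y c) (hd : d ≠ c) : v (residueIndicator p y d) < 1 := by
  obtain ⟨i, hi⟩ := Function.ne_iff.mp hd
  have hle (j : Fin m) : v (y j - primeFieldHom p E (d j)) ≤ 1 :=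
    v.map_sub_le (hc.valuation_le j) (valuation_primeFieldHom_le p v _)
  rw [residueIndicator, ← Finset.mul_prod_erase _ _ (Finset.mem_univ i), map_mul]
  refine mul_lt_one_of_nonneg_of_lt_one_left zero_le ?_ ?_
  · have hone : (primeFieldHom p E (c i - d i)) ^ (p - 1) = 1 := by
      rw [← map_pow, ZMod.pow_card_sub_one_eq_one (sub_ne_zero.mpr hi.symm), map_one]
    rw [← hone]
    refine v.map_pow_sub_pow_lt_one (valuation_primeFieldHom_le p v _) (hle i) ?_ _
    rw [_root_.map_sub (primeFieldHom p E), sub_sub_sub_cancel_right, v.map_sub_swap]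
    exact hc i
  · rw [map_prod]
    refine Finset.prod_le_one' fun j _ => v.map_sub_le v.map_one.le ?_
    rw [map_pow]
    exact pow_le_one₀ zero_le (hle j)

end

variable {f : Fin m → F} {y : Fin m → E}

theorem map_residueIndicator {F E : Type*} [Field F] [Field E] [CharP E p] [Algebra F E]
    {y : Fin m → E} (σ : E ≃ₐ[F] E) {b : Fin m → ZMod p}
    (hσ : ∀ i, σ (y i) = y i + primeFieldHom p E (b i)) (c : Fin m → ZMod p) :
    σ (residueIndicator p y c) = residueIndicator p y (c - b) := by
  simp only [residueIndicator, map_prod, map_sub, map_pow, map_one, hσ, Pi.sub_apply]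
  refine Finset.prod_congr rfl fun i _ => ?_
  rw [show σ (primeFieldHom p E (c i)) = primeFieldHom p E (c i) from
    map_primeFieldHom p (σ : E →+* E) (c i)]
  ring

/-- The residue of `y i` at the pullback of `W` along `σ` is that of `σ (y i)` at `W`. -/
theorem Valuation.HasResidues.comap {F E : Type*} [Field F] [Field E] [CharP E p] [Algebra F E]
    {y : Fin m → E} {W : ValuationSubring E}
    {σ : E ≃ₐ[F] E} {b c : Fin m → ZMod p} (hc : W.valuation.HasResidues p y c)
    (hσ : ∀ i, σ (y i) = y i + primeFieldHom p E (b i)) :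
    (ValuationSubring.comap W (σ : E →+* E)).valuation.HasResidues p y (c + b) := by
  intro i
  rw [← ValuationSubring.mem_nonunits_iff, ValuationSubring.mem_nonunits_iff_or,
    ValuationSubring.mem_comap, map_inv₀, ← map_eq_zero (σ : E →+* E),
    ← ValuationSubring.mem_nonunits_iff_or, ValuationSubring.mem_nonunits_iff, _root_.map_sub,
    map_primeFieldHom]
  convert hc i using 2
  change σ (y i) - _ = _
  rw [hσ, Pi.add_apply, _root_.map_add]
  ring

namespace IsArtinSchreierExtension

theorem exists_map_eq_add (h : IsArtinSchreierExtension p f y) (σ : E ≃ₐ[F] E) :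
    ∃ b : Fin m → ZMod p, ∀ i, σ (y i) = y i + primeFieldHom p E (b i) := by
  have (i : Fin m) : ∃ c : ZMod p, σ (y i) = y i + primeFieldHom p E c :=
    _root_.exists_map_eq_add p (h.root i) (by
      rw [← map_pow, ← map_sub, h.root i, AlgEquiv.commutes])
  choose b hb using this
  exact ⟨b, hb⟩

/-- An element `u` of `E` all of whose conjugates are integral at the places where the `y i` have
residues `c i` is congruent at these places to an element of `F`. -/
theorem exists_algebraMap_sub_lt_one (h : IsArtinSchreierExtension p f y) (c : Fin m → ZMod p)
    (u : E) : ∃ t : F, ∀ W : ValuationSubring E, W.valuation.HasResidues p y c →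
      (∀ σ : E ≃ₐ[F] E, σ u ∈ W) → W.valuation (algebraMap F E t - u) < 1 := by
  classical
  have := h.finite
  have := h.galois
  -- `t` is the trace of `u` times the indicator of `c`. Each `σ ≠ 1` moves the indicator to another
  -- vector, so at `W` only the term of `σ = 1` survives.
  obtain ⟨t, ht⟩ := (IsGalois.mem_range_algebraMap_iff_fixed
    (∑ σ : E ≃ₐ[F] E, σ (u * residueIndicator p y c))).mpr fun τ => by
      rw [map_sum]
      exact Fintype.sum_equiv (Equiv.mulLeft τ) _ _ fun σ => rfl
  refine ⟨t, fun W hc hu => ?_⟩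
  have hu' (σ : E ≃ₐ[F] E) : W.valuation (σ u) ≤ 1 := (W.valuation_le_one_iff _).mpr (hu σ)
  rw [ht, ← Finset.add_sum_erase _ _ (Finset.mem_univ 1), AlgEquiv.one_apply,
    show ∀ s e : E, u * e + s - u = u * (e - 1) + s by intros; ring]
  refine W.valuation.map_add_lt ?_ ?_
  · rw [map_mul]
    exact mul_lt_one_of_nonneg_of_lt_one_right (hu' 1) zero_le hc.residueIndicator_sub_one
  · refine W.valuation.map_sum_lt one_ne_zero fun σ hσ => ?_
    obtain ⟨b, hb⟩ := h.exists_map_eq_add σ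
    rw [map_mul, map_residueIndicator σ hb, map_mul]
    refine mul_lt_one_of_nonneg_of_lt_one_right (hu' σ) zero_le
      (hc.residueIndicator_of_ne fun hcb => ?_)
    refine (Finset.mem_erase.mp hσ).1 (h.eq_one σ fun i => ?_)
    rw [hb, show b = 0 by simpa using hcb]
    simp

variable {V : ValuationSubring F}

/-- Suppose `z` lies in `W` but not in `W'`. For a suitable `k`, the inverse of `g = 1 + z + ⋯ + z ^
(k - 1)` is a unit at `W`, vanishes at `W'`, and has all its conjugates integral at both. An element
`t` of `F` is then congruent to `g⁻¹` at both places, so `t` vanishes at `W'` but not at `W`,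
although both lie over `V`. -/
theorem le_of_hasResidues (h : IsArtinSchreierExtension p f y) {W W' : ValuationSubring E}
    (hW : W.comap (algebraMap F E) = V) (hW' : W'.comap (algebraMap F E) = V)
    {c : Fin m → ZMod p} (hc : W.valuation.HasResidues p y c)
    (hc' : W'.valuation.HasResidues p y c) : W ≤ W' := by
  have := h.finite
  intro z hz
  by_contra hz'
  have hev (A : ValuationSubring E) : ∀ᶠ k in Filter.atTop, ∀ σ : E ≃ₐ[F] E, k.Prime →
      1 ≤ A.valuation (∑ j ∈ Finset.range k, (σ z) ^ j) ∧
      (A.valuation (∑ j ∈ Finset.range k, (σ z) ^ j) = 1 ↔ σ z ∈ A) :=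
    Filter.eventually_all.mpr fun σ => A.eventually_valuation_geom_sum (σ z)
  -- One prime `k` serves all the finitely many conjugates of `z` at both places.
  obtain ⟨k, hk, hk1, hk2⟩ :=
    (Nat.frequently_atTop_iff_infinite.mpr Nat.infinite_setOfPred_prime).and_eventually
      ((hev W).and (hev W')) |>.exists
  set g := ∑ j ∈ Finset.range k, z ^ j with hg
  have hσg (σ : E ≃ₐ[F] E) : σ g = ∑ j ∈ Finset.range k, (σ z) ^ j := by simp [hg]
  have hmem {A : ValuationSubring E} (hA : ∀ σ : E ≃ₐ[F] E,
      1 ≤ A.valuation (∑ j ∈ Finset.range k, (σ z) ^ j)) (σ : E ≃ₐ[F] E) : σ g⁻¹ ∈ A := by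
    rw [← A.valuation_le_one_iff, map_inv₀, map_inv₀, hσg]
    exact inv_le_one_of_one_le₀ (hA σ)
  obtain ⟨t, ht⟩ := h.exists_algebraMap_sub_lt_one c g⁻¹
  have h1 := ht W hc (hmem fun σ => (hk1 σ hk).1)
  have h2 := ht W' hc' (hmem fun σ => (hk2 σ hk).1)
  have hgW : W.valuation g⁻¹ = 1 := by
    rw [map_inv₀, inv_eq_one]
    exact (hk1 1 hk).2.mpr hz
  have hgW' : W'.valuation g⁻¹ < 1 := by
    rw [map_inv₀]
    exact inv_lt_one_of_one_lt₀ ((hk2 1 hk).1.lt_of_ne fun he => hz' ((hk2 1 hk).2.mp he.symm))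
  have h3 : W'.valuation (algebraMap F E t) < 1 := by
    rw [← sub_add_cancel (algebraMap F E t) g⁻¹]
    exact W'.valuation.map_add_lt h2 hgW'
  have h4 : W.valuation (algebraMap F E t) < 1 := by
    rwa [ValuationSubring.valuation_algebraMap_lt_one_iff hW,
      ← ValuationSubring.valuation_algebraMap_lt_one_iff hW']
  refine lt_irrefl (1 : W.ValueGroup) ?_
  rw [← hgW] at h4 h1 ⊢
  have := W.valuation.map_sub_lt h4 h1
  rwa [sub_sub_cancel] at this

/-- A place at which all the `f i` vanish splits completely. -/
theorem ncard_comap_eq (h : IsArtinSchreierExtension p f y) (hV : ∀ i, V.valuation (f i) < 1) :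
    {W : ValuationSubring E | W.comap (algebraMap F E) = V}.ncard = p ^ m := by
  have hres (W : {W : ValuationSubring E // W.comap (algebraMap F E) = V}) :
      ∃ c, W.1.valuation.HasResidues p y c :=
    Valuation.exists_hasResidues fun i => by
      rw [h.root, ValuationSubring.valuation_algebraMap_lt_one_iff W.2]
      exact hV i
  choose r hr using hres
  have hbij : Function.Bijective r := by
    refine ⟨fun W W' hWW => Subtype.ext ?_, fun c => ?_⟩
    · have h' := hr W'
      rw [← hWW] at h'
      exact le_antisymm (h.le_of_hasResidues W.2 W'.2 (hr W) h')
        (h.le_of_hasResidues W'.2 W.2 h' (hr W))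
    · obtain ⟨W, hW⟩ := V.exists_comap_eq (E := E)
      -- One place over `V` exists; the translation by the difference turns its residue vector into
      -- `c`.
      obtain ⟨σ, hσ⟩ := h.exists_smul (c - r ⟨W, hW⟩)
      have hW' : (W.comap (σ : E →+* E)).comap (algebraMap F E) = V := by
        rw [← hW]
        ext x
        simp only [ValuationSubring.mem_comap]
        rw [show (σ : E →+* E) (algebraMap F E x) = algebraMap F E x from σ.commutes x]
      refine ⟨⟨_, hW'⟩, ?_⟩
      have := (hr ⟨W, hW⟩).comap hσ
      rw [add_sub_cancel] at this
      exact (hr _).unique this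
  rw [← Nat.card_coe_set_eq]
  refine (Nat.card_congr (Equiv.ofBijective r hbij)).trans ?_
  simp [Nat.card_eq_fintype_card, ZMod.card]

/-- If the `f i` vanish at a place whose residue field is the constant field `k`, then `k` is the
full constant field of `E`. -/
theorem isFullConstantField {k : Type*} [Field k] [Algebra k F] [Algebra k E] [IsScalarTower k F E]
    (h : IsArtinSchreierExtension p f y) (hV : ∀ i, V.valuation (f i) < 1)
    (hk : ∀ t ∈ V, ∃ a : k, V.valuation (t - algebraMap k F a) < 1)
    (hkV : ∀ a : k, algebraMap k F a ∈ V) : IsFullConstantField k E := by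
  intro z hz
  obtain ⟨W, hW⟩ := V.exists_comap_eq (E := E)
  -- Constants are integral over `k`, hence lie in the integrally closed ring `W`; this applies to
  -- all conjugates of `z`.
  have hmem (x : E) (hx : IsAlgebraic k x) : x ∈ W := by
    obtain ⟨q, hq, hqx⟩ := hx.isIntegral
    have hint : IsIntegral W x := by
      refine ⟨q.map ((algebraMap k E).codRestrict W.toSubring fun a => ?_), hq.map _, ?_⟩
      · rw [IsScalarTower.algebraMap_apply k F E]
        have := hkV a
        rw [← hW] at this
        exact this
      · rw [eval₂_map]
        exact hqx
    obtain ⟨w, hw⟩ := IsIntegrallyClosed.isIntegral_iff.mp hint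
    exact hw ▸ w.2
  obtain ⟨c, hc⟩ := Valuation.exists_hasResidues (p := p) (v := W.valuation) (y := y) fun i => by
    rw [h.root, ValuationSubring.valuation_algebraMap_lt_one_iff hW]
    exact hV i
  obtain ⟨t, ht⟩ := h.exists_algebraMap_sub_lt_one c z
  have h1 := ht W hc fun σ => hmem _
    (hz.isIntegral.map ((σ : E →ₐ[F] E).restrictScalars k)).isAlgebraic
  have ht : t ∈ V := by
    rw [← hW, ValuationSubring.mem_comap, ← sub_add_cancel (algebraMap F E t) z]
    exact W.add_mem _ _ ((W.valuation_le_one_iff _).mp h1.le) (hmem z hz)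
  obtain ⟨a, ha⟩ := hk t ht
  rw [← ValuationSubring.valuation_algebraMap_lt_one_iff hW, map_sub,
    ← IsScalarTower.algebraMap_apply] at ha
  -- Now `z - a` is a nonunit of `W`; were it nonzero, its inverse would be a constant, hence in
  -- `W`.
  have h2 := W.valuation.map_sub_lt ha h1
  rw [sub_sub_sub_cancel_left, ← ValuationSubring.mem_nonunits_iff,
    ValuationSubring.mem_nonunits_iff_or] at h2
  refine ⟨a, ?_⟩
  rcases h2 with h2 | h2
  · exact (sub_eq_zero.mp h2).symm
  · exact absurd (hmem _ (hz.sub (isAlgebraic_algebraMap a)).inv) h2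

end IsArtinSchreierExtension

end Splitting

/-! ### The functions `f i` on the projective line -/

section RationalFunctionField

namespace RatFunc

variable {K : Type*} [Field K]

/-- A rational function with a nontrivial squarefree denominator is not of the form `w ^ n - w`. -/
theorem eq_zero_of_pow_sub_eq_div {n : ℕ} (hn : 2 ≤ n) {N D : K[X]} (hD : Squarefree D)
    (hdeg : N.degree < D.degree) {w : RatFunc K}
    (hw : w ^ n - w = algebraMap K[X] (RatFunc K) N / algebraMap K[X] (RatFunc K) D) : N = 0 := by
  obtain ⟨k, rfl⟩ : ∃ k, n = k + 2 := ⟨n - 2, by omega⟩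
  have hD0 : algebraMap K[X] (RatFunc K) D ≠ 0 := by simpa using hD.ne_zero
  have hb0 : algebraMap K[X] (RatFunc K) w.denom ≠ 0 := by simpa using w.denom_ne_zero
  have key : (w.num ^ (k + 2) - w.num * w.denom ^ (k + 1)) * D = N * w.denom ^ (k + 2) := by
    apply IsFractionRing.injective K[X] (RatFunc K)
    rw [← w.num_div_denom, div_pow] at hw
    simp only [map_mul, map_sub, map_pow]
    field_simp at hw
    apply mul_right_cancel₀ hb0
    linear_combination hw
  -- By coprimality the power of `w.denom` in `key` divides `D`. As the exponent is at least `2` and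
  -- `D` is squarefree, `w` is a polynomial, whence `D ∣ N`.
  have hcop : IsCoprime (w.denom ^ (k + 2)) (w.num ^ (k + 2) - w.num * w.denom ^ (k + 1)) := by
    apply IsCoprime.pow_left
    rw [show w.num ^ (k + 2) - w.num * w.denom ^ (k + 1)
      = w.num ^ (k + 2) + w.denom * (-(w.num * w.denom ^ k)) by ring]
    exact IsCoprime.add_mul_left_right (w.isCoprime_num_denom.symm.pow_right) _
  have hdvd : w.denom ^ (k + 2) ∣ D :=
    hcop.dvd_of_dvd_mul_left (key ▸ Dvd.intro_left _ rfl)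
  have hunit : IsUnit w.denom := hD _ ((Dvd.intro_left (w.denom ^ k) (by ring)).trans hdvd)
  have hDN : D ∣ N := (hunit.pow (k + 2)).dvd_mul_right.mp (key ▸ Dvd.intro_left _ rfl)
  exact eq_zero_of_dvd_of_degree_lt hDN hdeg

end RatFunc

variable (K : Type*) [Field K]

/-- The polynomial `X ^ q - X` vanishing at all elements of the finite field with `q` elements. -/
noncomputable def vanishingPoly : K[X] := X ^ Nat.card K - X

/-- The polynomial `(X ^ q - X) ^ n + 1`, without zeros in the finite field with `q` elements. -/
noncomputable def poleDivisorPoly (n : ℕ) : K[X] := vanishingPoly K ^ n + 1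

theorem isCoprime_vanishingPoly_poleDivisorPoly (n : ℕ) :
    IsCoprime (vanishingPoly K) (poleDivisorPoly K (n + 1)) :=
  ⟨-vanishingPoly K ^ n, 1, by rw [poleDivisorPoly]; ring⟩

/-- The functions `X ^ i (X ^ q - X) / ((X ^ q - X) ^ (p m + 1) + 1)`: they vanish at all rational
places, and have simple poles. -/
noncomputable def artinSchreierFun (p m : ℕ) (i : Fin m) : RatFunc K :=
  algebraMap K[X] (RatFunc K) (X ^ (i : ℕ) * vanishingPoly K) /
    algebraMap K[X] (RatFunc K) (poleDivisorPoly K (p * m + 1))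

variable [Finite K]

theorem natDegree_vanishingPoly : (vanishingPoly K).natDegree = Nat.card K :=
  FiniteField.X_pow_card_sub_X_natDegree_eq K Finite.one_lt_card

theorem vanishingPoly_ne_zero : vanishingPoly K ≠ 0 :=
  FiniteField.X_pow_card_sub_X_ne_zero K Finite.one_lt_card

theorem natDegree_poleDivisorPoly (n : ℕ) :
    (poleDivisorPoly K n).natDegree = n * Nat.card K := by
  rw [poleDivisorPoly, ← C_1, natDegree_add_C, natDegree_pow, natDegree_vanishingPoly]

theorem poleDivisorPoly_ne_zero (n : ℕ) (hn : n ≠ 0) : poleDivisorPoly K n ≠ 0 := by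
  intro h
  have := natDegree_poleDivisorPoly K n
  rw [h, natDegree_zero] at this
  exact (Nat.mul_pos (Nat.pos_of_ne_zero hn) Nat.card_pos).ne this

theorem derivative_vanishingPoly : derivative (vanishingPoly K) = -1 := by
  have := Fintype.ofFinite K
  simp [vanishingPoly, derivative_X_pow, Nat.card_eq_fintype_card]

/-- The exponent is `1` modulo `p` and `s' = -1`, so `D' = -s ^ (p * m)` and `D + s * D' = 1`. -/
theorem separable_poleDivisorPoly (p m : ℕ) [CharP K p] :
    (poleDivisorPoly K (p * m + 1)).Separable := by
  refine ⟨1, vanishingPoly K, ?_⟩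
  rw [poleDivisorPoly, derivative_add, derivative_one, derivative_pow, derivative_vanishingPoly]
  simp
  ring

/-- A combination of the functions is `h * s / D`, where `h` has the coefficients `a i` and degree
below `m`. The exponent `p * m + 1` is large enough to make this fraction proper. -/
theorem artinSchreierIndependent_artinSchreierFun (p m : ℕ) [hp : Fact p.Prime] [CharP K p]
    [CharP (RatFunc K) p] : ArtinSchreierIndependent p (artinSchreierFun K p m) := by
  intro a w hw
  let h : K[X] := ∑ i : Fin m, C (primeFieldHom p K (a i)) * X ^ (i : ℕ)
  have hw' : w ^ p - w = algebraMap K[X] (RatFunc K) (h * vanishingPoly K) /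
      algebraMap K[X] (RatFunc K) (poleDivisorPoly K (p * m + 1)) := by
    rw [hw, map_mul, map_sum, Finset.sum_mul, Finset.sum_div]
    refine Finset.sum_congr rfl fun i _ => ?_
    rw [artinSchreierFun, ← map_primeFieldHom p (algebraMap K (RatFunc K)), map_mul, map_mul,
      IsScalarTower.algebraMap_apply K K[X] (RatFunc K), ← Polynomial.C_eq_algebraMap]
    ring
  have hdegh : h.degree < m := by
    refine (degree_sum_fin_lt (n := m) fun i => primeFieldHom p K (a i)).trans_le le_rfl
  have hzero := RatFunc.eq_zero_of_pow_sub_eq_div hp.out.two_le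
    (separable_poleDivisorPoly K p m).squarefree (N := h * vanishingPoly K) (by
      by_cases h0 : h = 0
      · rw [h0, zero_mul, degree_zero, bot_lt_iff_ne_bot, Ne, degree_eq_bot]
        exact poleDivisorPoly_ne_zero K _ (Nat.succ_ne_zero _)
      · have hlt : h.natDegree < m := (natDegree_lt_iff_degree_lt h0).mpr hdegh
        apply degree_lt_degree
        rw [natDegree_mul h0 (vanishingPoly_ne_zero K), natDegree_vanishingPoly,
          natDegree_poleDivisorPoly, add_mul, one_mul]
        have h1 : 1 ≤ Nat.card K := Nat.card_pos
        have h2 := hp.out.two_le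
        nlinarith [Nat.mul_le_mul (Nat.mul_le_mul hp.out.one_le (le_refl m)) h1]) hw'
  have hh : h = 0 := (mul_eq_zero.mp hzero).resolve_right (vanishingPoly_ne_zero K)
  funext i
  have hcoef : h.coeff i = primeFieldHom p K (a i) := by
    simp only [h, finsetSum_coeff, coeff_C_mul, coeff_X_pow]
    rw [Finset.sum_eq_single i (fun j _ hj => by simp [Fin.val_inj, hj.symm]) (by simp)]
    simp
  rw [hh, coeff_zero] at hcoef
  exact ((map_eq_zero _).mp hcoef.symm)

variable {K}

theorem Place.IsRational.exists_sub_algebraMap_lt_one {k F : Type*} [Field k] [Field F]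
    [Algebra k F] {P : Place k F} (hP : P.IsRational) {t : F} (ht : t ∈ P.ring) :
    ∃ a : k, P.ring.valuation (t - algebraMap k F a) < 1 := by
  obtain ⟨a, ha⟩ := (finrank_eq_one_iff_of_nonzero'
    (1 : IsLocalRing.ResidueField P.ring) one_ne_zero).mp hP (IsLocalRing.residue _ ⟨t, ht⟩)
  refine ⟨a, ?_⟩
  have h : IsLocalRing.residue P.ring (⟨t, ht⟩ - algebraMap k P.ring a) = 0 := by
    rw [map_sub, ← ha, Algebra.smul_def, mul_one]
    exact sub_self _
  exact (P.ring.valuation_lt_one_iff _).mp ((IsLocalRing.residue_eq_zero_iff _).mp h)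

theorem valuation_artinSchreierFun_lt_one {p m : ℕ} (hp : p ≠ 0)
    {P : Place K (RatFunc K)} (hP : P.IsRational) (i : Fin m) :
    P.ring.valuation (artinSchreierFun K p m i) < 1 := by
  have hm : 0 < m := i.pos
  set v := P.ring.valuation with hv
  set q := Nat.card K with hq
  have hq1 : 1 < q := Finite.one_lt_card
  have hs : algebraMap K[X] (RatFunc K) (vanishingPoly K) = RatFunc.X ^ q - RatFunc.X := by
    simp [vanishingPoly, hq]
  have hD : algebraMap K[X] (RatFunc K) (poleDivisorPoly K (p * m + 1))
      = (RatFunc.X ^ q - RatFunc.X) ^ (p * m + 1) + 1 := by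
    simp [poleDivisorPoly, hs]
  rw [artinSchreierFun, map_div₀, hD, map_mul, hs, map_pow, RatFunc.algebraMap_X, map_mul,
    map_pow v]
  by_cases hX : RatFunc.X ∈ P.ring
  · obtain ⟨a, ha⟩ := hP.exists_sub_algebraMap_lt_one hX
    have hXle : v RatFunc.X ≤ 1 := (P.ring.valuation_le_one_iff _).mpr hX
    have hale : v (algebraMap K (RatFunc K) a) ≤ 1 :=
      (P.ring.valuation_le_one_iff _).mpr (P.algebraMap_mem a)
    -- With `a` the residue of `X`, `a ^ q = a` makes `s` vanish; then `D` has residue `1`.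
    have hsv : v (RatFunc.X ^ q - RatFunc.X) < 1 := by
      have haq : algebraMap K (RatFunc K) a ^ q = algebraMap K (RatFunc K) a := by
        have := Fintype.ofFinite K
        rw [← map_pow, hq, Nat.card_eq_fintype_card, FiniteField.pow_card]
      rw [show (RatFunc.X ^ q - RatFunc.X : RatFunc K)
        = (RatFunc.X ^ q - algebraMap K (RatFunc K) a ^ q)
          - (RatFunc.X - algebraMap K (RatFunc K) a) by rw [haq]; ring]
      exact v.map_sub_lt (v.map_pow_sub_pow_lt_one hXle hale ha q) ha
    rw [Valuation.map_add_eq_of_lt_right v (by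
      rw [map_pow, map_one]
      exact pow_lt_one₀ zero_le hsv (Nat.succ_ne_zero _)), map_one, div_one]
    exact mul_lt_one_of_nonneg_of_lt_one_right (pow_le_one₀ zero_le hXle) zero_le hsv
  -- At the pole of `X` leading terms dominate, and it remains to compare the degrees `i + q` and `q
  -- * (p * m + 1)`.
  · have hX1 : 1 < v RatFunc.X := by
      rwa [← not_le, P.ring.valuation_le_one_iff]
    have hsv : v (RatFunc.X ^ q - RatFunc.X) = v RatFunc.X ^ q := by
      rw [Valuation.map_sub_eq_of_lt_left, map_pow]
      rw [map_pow]
      exact lt_self_pow₀ hX1 hq1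
    have hDv : v ((RatFunc.X ^ q - RatFunc.X) ^ (p * m + 1) + 1)
        = v RatFunc.X ^ (q * (p * m + 1)) := by
      rw [Valuation.map_add_eq_of_lt_left, map_pow, hsv, pow_mul]
      rw [map_one, map_pow, hsv, ← pow_mul]
      exact one_lt_pow₀ hX1 (Nat.mul_ne_zero (by omega) (Nat.succ_ne_zero _))
    rw [hDv, hsv, ← pow_add, div_lt_one₀ (pow_pos (zero_lt_one.trans hX1) _)]
    refine pow_lt_pow_right₀ hX1 ?_
    have := i.2
    have h2 : m ≤ p * m := Nat.le_mul_of_pos_left m (Nat.pos_of_ne_zero hp)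
    have h3 : p * m ≤ q * (p * m) := Nat.le_mul_of_pos_left _ (by omega)
    rw [mul_add, mul_one]
    omega

end RationalFunctionField

/-! ### Wild ramification at simple poles -/

section WildRamification

theorem Ideal.ramificationIdx'_maximalIdeal_eq {R S : Type*} [CommRing R] [IsLocalRing R]
    [CommRing S] [IsDomain S] [IsDiscreteValuationRing S] [Algebra R S] {π : R}
    (hπ : IsLocalRing.maximalIdeal R = Ideal.span {π}) {ϖ : S} (hϖ : Irreducible ϖ) {n : ℕ}
    (h : Associated (algebraMap R S π) (ϖ ^ n)) :
    Ideal.ramificationIdx' (IsLocalRing.maximalIdeal R) (IsLocalRing.maximalIdeal S) = n := by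
  have hmap : Ideal.map (algebraMap R S) (IsLocalRing.maximalIdeal R)
      = IsLocalRing.maximalIdeal S ^ n := by
    rw [hπ, Ideal.map_span, Set.image_singleton, hϖ.maximalIdeal_eq, Ideal.span_singleton_pow,
      Ideal.span_singleton_eq_span_singleton]
    exact h
  refine Ideal.ramificationIdx'_spec hmap.le fun hle => ?_
  rw [hmap, hϖ.maximalIdeal_eq, Ideal.span_singleton_pow, Ideal.span_singleton_pow,
    Ideal.span_singleton_le_span_singleton, pow_dvd_pow_iff hϖ.ne_zero hϖ.not_isUnit] at hle
  omega

open IsDedekindDomain HeightOneSpectrum in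
theorem isDiscreteValuationRing_valuationSubringAtPrime {B E : Type*} [CommRing B]
    [IsDedekindDomain B] [Field E] [Algebra B E] [IsFractionRing B E] (w : HeightOneSpectrum B) :
    IsDiscreteValuationRing (valuationSubringAtPrime E w) :=
  have : IsLocalization.AtPrime (valuationSubringAtPrime E w) w.asIdeal :=
    inferInstanceAs (IsLocalization w.asIdeal.primeCompl (valuationSubringAtPrime E w))
  IsLocalization.AtPrime.isDiscreteValuationRing_of_dedekind_domain B w.ne_bot _

open IsDedekindDomain HeightOneSpectrum in
theorem maximalIdeal_valuationSubringAtPrime {B E : Type*} [CommRing B]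
    [IsDedekindDomain B] [Field E] [Algebra B E] [IsFractionRing B E] (w : HeightOneSpectrum B) :
    IsLocalRing.maximalIdeal (valuationSubringAtPrime E w) =
      w.asIdeal.map (algebraMap B (valuationSubringAtPrime E w)) :=
  have : IsLocalization.AtPrime (valuationSubringAtPrime E w) w.asIdeal :=
    inferInstanceAs (IsLocalization w.asIdeal.primeCompl (valuationSubringAtPrime E w))
  (IsLocalization.AtPrime.map_eq_maximalIdeal w.asIdeal _).symm

open IsDedekindDomain HeightOneSpectrum in
-- The integral closure of `A` in `E` is Dedekind; localizing it at a prime over `v` gives a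
-- discrete ring, in which ramification can be read off from a uniformizer.
theorem exists_valuationSubring_lies_over {A F E : Type*} [CommRing A] [IsDedekindDomain A]
    [Field F] [Algebra A F] [IsFractionRing A F] [Field E] [Algebra F E] [FiniteDimensional F E]
    [Algebra.IsSeparable F E] (v : HeightOneSpectrum A) :
    ∃ W : ValuationSubring E, IsDiscreteValuationRing W ∧
      W.comap (algebraMap F E) = valuationSubringAtPrime F v := by
  let : Algebra A E := ((algebraMap F E).comp (algebraMap A F)).toAlgebra
  have : IsScalarTower A F E := IsScalarTower.of_algebraMap_eq fun _ => rfl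
  let B := integralClosure A E
  have : IsFractionRing B E := integralClosure.isFractionRing_of_finite_extension F E
  have : IsDedekindDomain B := integralClosure.isDedekindDomain A F E
  have hAE : Function.Injective (algebraMap A E) :=
    (algebraMap F E).injective.comp (IsFractionRing.injective A F)
  have : FaithfulSMul A B := (faithfulSMul_iff_algebraMap_injective A B).mpr fun a b hab =>
    hAE (congrArg (algebraMap B E) hab)
  obtain ⟨⟨𝔮, h𝔮, hover⟩⟩ := (inferInstance : Nonempty (v.asIdeal.primesOver B))
  let w : HeightOneSpectrum B := ⟨𝔮, h𝔮, Ideal.ne_bot_of_liesOver_of_ne_bot v.ne_bot 𝔮⟩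
  refine ⟨valuationSubringAtPrime E w, isDiscreteValuationRing_valuationSubringAtPrime w, ?_⟩
  have hle : valuationSubringAtPrime F v ≤
      (valuationSubringAtPrime E w).comap (algebraMap F E) := by
    rintro x ⟨a, s, hs, rfl⟩
    refine ⟨algebraMap A B a, algebraMap A B s, fun hsw => hs ?_, ?_⟩
    · rw [hover.over]
      exact hsw
    · rw [map_mul, map_inv₀, ← IsScalarTower.algebraMap_apply A F E,
        ← IsScalarTower.algebraMap_apply A F E, ← IsScalarTower.algebraMap_apply A B E,
        ← IsScalarTower.algebraMap_apply A B E]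
  refine (ValuationSubring.eq_of_le_of_ne_top _ hle fun htop => ?_).symm
  obtain ⟨b, hb, hb0⟩ := Submodule.exists_mem_ne_zero_of_ne_bot v.ne_bot
  have hmem : (algebraMap F E (algebraMap A F b))⁻¹ ∈ valuationSubringAtPrime E w := by
    rw [← map_inv₀, ← ValuationSubring.mem_comap, htop]
    exact ValuationSubring.mem_top _
  rw [valuationSubringAtPrime_eq_valuationSubring, Valuation.mem_valuationSubring_iff, map_inv₀,
    ← IsScalarTower.algebraMap_apply A F E, IsScalarTower.algebraMap_apply A B E] at hmem
  have hlt : w.valuation E (algebraMap B E (algebraMap A B b)) < 1 := by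
    rw [valuation_lt_one_iff_mem]
    have : b ∈ 𝔮.under A := hover.over ▸ hb
    exact this
  have hpos : 0 < w.valuation E (algebraMap B E (algebraMap A B b)) := by
    rw [zero_lt_iff, Ne, map_eq_zero, ← IsScalarTower.algebraMap_apply A B E]
    exact fun h => hb0 (hAE (h.trans (map_zero _).symm))
  exact hmem.not_gt ((one_lt_inv₀ hpos).mpr hlt)

open IsDedekindDomain HeightOneSpectrum in
/-- An Artin–Schreier equation `y ^ p - y = N / D`, where `D` is squarefree and prime to `N`, forces
wild ramification at the zeros of `D`. -/
theorem isWildlyRamifiedExtension_of_pow_sub_eq {k : Type*} [Field k] {p : ℕ} [Fact p.Prime]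
    [CharP k p] {E : Type*} [Field E] [Algebra k E] [Algebra (RatFunc k) E]
    [IsScalarTower k (RatFunc k) E]
    [FiniteDimensional (RatFunc k) E] [Algebra.IsSeparable (RatFunc k) E]
    {N D : k[X]} (hD : Squarefree D) (hunit : ¬ IsUnit D) (hcop : IsCoprime N D) {y : E}
    (hy : y ^ p - y = algebraMap (RatFunc k) E
      (algebraMap k[X] (RatFunc k) N / algebraMap k[X] (RatFunc k) D)) :
    IsWildlyRamifiedExtension k (RatFunc k) E := by
  have hp : p.Prime := Fact.out
  obtain ⟨g, hg, h, rfl⟩ := WfDvdMonoid.exists_irreducible_factor hunit hD.ne_zero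
  let v : HeightOneSpectrum k[X] :=
    ⟨Ideal.span {g}, (Ideal.span_singleton_prime hg.ne_zero).mpr hg.prime,
      by simpa using hg.ne_zero⟩
  obtain ⟨W, hW, hWV⟩ := exists_valuationSubring_lies_over (F := RatFunc k) (E := E) v
  set V := valuationSubringAtPrime (RatFunc k) v
  have hVle (a : k[X]) : algebraMap k[X] (RatFunc k) a ∈ V := (algebraMap k[X] V a).2
  have hkV (a : k) : algebraMap k (RatFunc k) a ∈ V := by
    rw [IsScalarTower.algebraMap_apply k k[X] (RatFunc k)]
    exact hVle _
  let πV : V := algebraMap k[X] V g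
  have hmax : IsLocalRing.maximalIdeal V = Ideal.span {πV} := by
    rw [maximalIdeal_valuationSubringAtPrime v]
    exact (Ideal.map_span _ _).trans (by rw [Set.image_singleton])
  have hπV : ¬ IsUnit πV := by
    rw [← mem_nonunits_iff, ← IsLocalRing.mem_maximalIdeal, hmax]
    exact Ideal.mem_span_singleton_self _
  have hVtop : V ≠ ⊤ := by
    intro htop
    have hg0 : algebraMap k[X] (RatFunc k) g ≠ 0 := by simpa using hg.ne_zero
    have hinv : (algebraMap k[X] (RatFunc k) g)⁻¹ ∈ V := htop ▸ ValuationSubring.mem_top _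
    have hu : IsUnit πV := IsUnit.of_mul_eq_one ⟨_, hinv⟩ (Subtype.ext (mul_inv_cancel₀ hg0))
    exact hπV hu
  let P : Place k (RatFunc k) := ⟨V, hkV, hVtop⟩
  let Q : Place k E := ⟨W, fun a => by
    rw [IsScalarTower.algebraMap_apply k (RatFunc k) E, ← ValuationSubring.mem_comap, hWV]
    exact hkV a, fun htop => hVtop (by rw [← hWV, htop]; rfl)⟩
  have hQP : Q.LiesOver P := hWV
  obtain ⟨ϖ, hϖ⟩ := IsDiscreteValuationRing.exists_irreducible W
  let ι : k[X] →+* W := hQP.ringHom.comp (algebraMap k[X] V)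
  have hι (a : k[X]) : (ι a : E) = algebraMap (RatFunc k) E (algebraMap k[X] (RatFunc k) a) := rfl
  have hιg : ¬ IsUnit (ι g) := by
    intro hu
    obtain ⟨x, hx⟩ := hu.exists_right_inv
    have hx' : algebraMap (RatFunc k) E (algebraMap k[X] (RatFunc k) g) * x = 1 :=
      congrArg Subtype.val hx
    have hinv : (algebraMap k[X] (RatFunc k) g)⁻¹ ∈ V := by
      rw [← hWV, ValuationSubring.mem_comap, map_inv₀, ← eq_inv_of_mul_eq_one_right hx']
      exact x.2
    have hg0 : algebraMap k[X] (RatFunc k) g ≠ 0 := by simpa using hg.ne_zero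
    exact hπV (IsUnit.of_mul_eq_one ⟨_, hinv⟩ (Subtype.ext (mul_inv_cancel₀ hg0)))
  have hunit_of_coprime {a : k[X]} (ha : IsCoprime g a) : IsUnit (ι a) := by
    obtain ⟨b, c, hbc⟩ := ha.map ι
    rcases IsLocalRing.isUnit_or_isUnit_of_add_one hbc with hu | hu
    · exact absurd (isUnit_of_mul_isUnit_right hu) hιg
    · exact isUnit_of_mul_isUnit_right hu
  -- Squarefreeness of `g * h` makes the pole at `g` simple.
  have hh : IsUnit (ι h) := by
    refine hunit_of_coprime ((EuclideanDomain.dvd_or_coprime _ _ hg).resolve_left fun hdvd => ?_)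
    exact hg.not_isUnit (hD g (mul_dvd_mul_left g hdvd))
  have hN : IsUnit (ι N) := hunit_of_coprime hcop.symm.of_mul_left_left
  have hD0 : algebraMap (RatFunc k) E (algebraMap k[X] (RatFunc k) (g * h)) ≠ 0 := by
    rw [Ne, map_eq_zero]
    simpa using hD.ne_zero
  rw [map_div₀, eq_div_iff hD0, map_mul, map_mul] at hy
  have hyW : y ∉ W := by
    intro hyW
    have hy' : ((⟨y, hyW⟩ : W) ^ p - ⟨y, hyW⟩) * (ι g * ι h) = ι N := Subtype.ext hy
    rw [← hy'] at hN
    exact hιg (isUnit_of_mul_isUnit_left (isUnit_of_mul_isUnit_right hN))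
  have hy0 : y ≠ 0 := fun h0 => hyW (h0 ▸ W.zero_mem)
  let w : W := ⟨y⁻¹, (W.mem_or_inv_mem y).resolve_left hyW⟩
  have hw0 : w ≠ 0 := fun h0 => inv_ne_zero hy0 (congrArg Subtype.val h0)
  have hw : ¬ IsUnit w := by
    intro hu
    obtain ⟨x, hx⟩ := hu.exists_right_inv
    have hx' : y⁻¹ * x = 1 := congrArg Subtype.val hx
    rw [inv_mul_eq_one₀ hy0] at hx'
    exact hyW (hx' ▸ x.2)
  have hwu : IsUnit (1 - w ^ (p - 1)) := by
    refine IsLocalRing.isUnit_one_sub_self_of_mem_nonunits _ ?_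
    rw [mem_nonunits_iff, isUnit_pow_iff (Nat.sub_ne_zero_of_lt hp.one_lt)]
    exact hw
  -- The equation multiplied by `w ^ p`, where `w = y⁻¹`. All factors except `g` and `w ^ p` are
  -- units, so `e` is `p` times the order of `w`.
  have key : ι g * (ι h * (1 - w ^ (p - 1))) = w ^ p * ι N := by
    obtain ⟨l, rfl⟩ : ∃ l, p = l + 1 := ⟨p - 1, (Nat.succ_pred_prime hp).symm⟩
    apply Subtype.ext
    change (ι g : E) * ((ι h : E) * (1 - y⁻¹ ^ l)) = y⁻¹ ^ (l + 1) * (ι N : E)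
    rw [hι N, ← hy, hι, hι]
    have h1 : y * y⁻¹ = 1 := mul_inv_cancel₀ hy0
    have h2 : y ^ (l + 1) * y⁻¹ ^ (l + 1) = 1 := by rw [← mul_pow, h1, one_pow]
    set G := algebraMap (RatFunc k) E (algebraMap k[X] (RatFunc k) g)
    set H := algebraMap (RatFunc k) E (algebraMap k[X] (RatFunc k) h)
    linear_combination (-(G * H)) * h2 + G * H * y⁻¹ ^ l * h1
  obtain ⟨n, hn⟩ := IsDiscreteValuationRing.associated_pow_irreducible hw0 hϖ
  have hn0 : n ≠ 0 := by
    rintro rfl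
    exact hw (hn.symm.isUnit (by simp))
  have hassoc : Associated (ι g) (ϖ ^ (n * p)) := by
    rw [pow_mul]
    refine Associated.trans ?_ (hn.pow_pow (n := p))
    exact (associated_mul_unit_right _ _ (hh.mul hwu)).trans
      (key ▸ associated_mul_unit_left _ _ hN)
  have he : hQP.ramificationIdx = n * p := by
    let : Algebra P.ring Q.ring := hQP.ringHom.toAlgebra
    have : IsDiscreteValuationRing Q.ring := hW
    exact Ideal.ramificationIdx'_maximalIdeal_eq hmax hϖ hassoc
  refine ⟨P, Q, hQP, ?_, ?_⟩
  · rw [he]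
    exact hp.one_lt.trans_le (Nat.le_mul_of_pos_left p (Nat.pos_of_ne_zero hn0))
  · rw [he, ringChar.eq k p]
    exact Dvd.intro_left n rfl

end WildRamification

/-! ### A rational place, and the main theorem -/

section MainTheorem

theorem Place.isRational_of_exists_sub_algebraMap_lt_one {k F : Type*} [Field k] [Field F]
    [Algebra k F] {P : Place k F}
    (h : ∀ t ∈ P.ring, ∃ a : k, P.ring.valuation (t - algebraMap k F a) < 1) : P.IsRational := by
  refine (finrank_eq_one_iff_of_nonzero' (1 : IsLocalRing.ResidueField P.ring)
    one_ne_zero).mpr fun r => ?_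
  obtain ⟨⟨t, ht⟩, rfl⟩ := IsLocalRing.residue_surjective r
  obtain ⟨a, ha⟩ := h t ht
  refine ⟨a, ?_⟩
  have h0 : IsLocalRing.residue P.ring (⟨t, ht⟩ - algebraMap k P.ring a) = 0 :=
    (IsLocalRing.residue_eq_zero_iff _).mpr ((P.ring.valuation_lt_one_iff _).mpr ha)
  rw [map_sub, sub_eq_zero] at h0
  rw [h0, Algebra.smul_def, mul_one]
  rfl

open IsDedekindDomain HeightOneSpectrum in
/-- At the place `X = 0` of the rational function field the residue field is the constant field. -/
theorem exists_isRational (k : Type*) [Field k] : ∃ P : Place k (RatFunc k), P.IsRational := by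
  let v : HeightOneSpectrum k[X] :=
    ⟨Ideal.span {X}, (Ideal.span_singleton_prime X_ne_zero).mpr prime_X, by simp⟩
  set V := valuationSubringAtPrime (RatFunc k) v
  have hX {a : k[X]} (ha : a.eval 0 = 0) :
      algebraMap k[X] V a ∈ IsLocalRing.maximalIdeal V := by
    rw [maximalIdeal_valuationSubringAtPrime v]
    refine Ideal.mem_map_of_mem _ (Ideal.mem_span_singleton.mpr (X_dvd_iff.mpr ?_))
    rwa [coeff_zero_eq_eval_zero]
  have hXV : (RatFunc.X : RatFunc k)⁻¹ ∉ V := by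
    intro hmem
    have hu : IsUnit (algebraMap k[X] V X) :=
      IsUnit.of_mul_eq_one ⟨_, hmem⟩ (Subtype.ext (by
        change algebraMap k[X] (RatFunc k) X * RatFunc.X⁻¹ = 1
        rw [RatFunc.algebraMap_X, mul_inv_cancel₀ RatFunc.X_ne_zero]))
    exact (IsLocalRing.mem_maximalIdeal _).mp (hX eval_X) hu
  let P : Place k (RatFunc k) := ⟨V, fun a => by
    rw [IsScalarTower.algebraMap_apply k k[X] (RatFunc k)]
    exact (algebraMap k[X] V _).2, fun htop => hXV (htop ▸ ValuationSubring.mem_top _)⟩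
  refine ⟨P, Place.isRational_of_exists_sub_algebraMap_lt_one fun t ht => ?_⟩
  obtain ⟨a, s, hs, rfl⟩ := id ht
  have hs0 : s.eval 0 ≠ 0 := by
    rw [← coeff_zero_eq_eval_zero, Ne, ← X_dvd_iff]
    exact fun hdvd => hs (Ideal.mem_span_singleton.mpr hdvd)
  have hsne : algebraMap k[X] (RatFunc k) s ≠ 0 := by
    rw [Ne, FaithfulSMul.algebraMap_eq_zero_iff]
    rintro rfl
    exact hs0 eval_zero
  have hsinv : (algebraMap k[X] (RatFunc k) s)⁻¹ ∈ V :=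
    ⟨1, s, hs, by rw [map_one, one_mul]⟩
  -- The value of `a / s` at `0`, so that `a - C c * s` vanishes there.
  let c : k := a.eval 0 / s.eval 0
  refine ⟨c, ?_⟩
  have hmul := Ideal.mul_mem_right (⟨_, hsinv⟩ : V) _ (hX (a := a - C c * s) (by
    rw [eval_sub, eval_mul, eval_C, div_mul_cancel₀ _ hs0, sub_self]))
  convert (V.valuation_lt_one_iff _).mp hmul using 2
  change algebraMap k[X] (RatFunc k) a * (algebraMap k[X] (RatFunc k) s)⁻¹ -
    algebraMap k (RatFunc k) c =
      algebraMap k[X] (RatFunc k) (a - C c * s) * (algebraMap k[X] (RatFunc k) s)⁻¹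
  rw [IsScalarTower.algebraMap_apply k k[X] (RatFunc k), ← Polynomial.C_eq_algebraMap, map_sub,
    map_mul]
  field_simp

theorem Place.splitsCompletely_of_ncard {k F E : Type*} [Field k] [Field F] [Algebra k F] [Field E]
    [Algebra k E] [Algebra F E] [IsScalarTower k F E] (P : Place k F)
    (h : {W : ValuationSubring E | W.comap (algebraMap F E) = P.ring}.ncard
      = Module.finrank F E) : P.SplitsCompletely E := by
  rw [SplitsCompletely, ← h]
  refine Set.ncard_congr (fun Q _ => Q.ring) (fun Q hQ => hQ) (fun Q Q' _ _ h => Place.ext h)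
    fun W hW => ?_
  refine ⟨⟨W, fun a => ?_, fun htop => P.ne_top ?_⟩, hW, rfl⟩
  · rw [IsScalarTower.algebraMap_apply k F E, ← ValuationSubring.mem_comap, hW]
    exact P.algebraMap_mem a
  · rw [← show W.comap (algebraMap F E) = P.ring from hW, htop]
    rfl

theorem mainTheorem7 (K : Type u) [Field K] [Finite K]
    (hprime : ¬ (Nat.card K).Prime) (hcard : 4 < Nat.card K)
    (p : ℕ) [CharP K p] (m : ℕ) (hm : 1 ≤ m) :
    ∃ (E : Type u) (_ : Field E) (_ : Algebra K E) (_ : Algebra (RatFunc K) E)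
      (_ : IsScalarTower K (RatFunc K) E),
      FiniteDimensional (RatFunc K) E ∧
      Algebra.IsSeparable (RatFunc K) E ∧
      Module.finrank (RatFunc K) E = p ^ m ∧
      IsFullConstantField K E ∧
      IsWildlyRamifiedExtension K (RatFunc K) E ∧
      ∀ P : Place K (RatFunc K), P.IsRational → P.SplitsCompletely E := by
  have hp : Fact p.Prime := ⟨CharP.char_is_prime K p⟩
  have : CharP (RatFunc K) p := charP_of_injective_algebraMap (algebraMap K (RatFunc K)).injective p
  have hind := artinSchreierIndependent_artinSchreierFun K p m
  let f := artinSchreierFun K p m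
  let E := SplittingField (∏ i, (X ^ p - X - C (f i)))
  have : CharP E p := charP_of_injective_algebraMap (algebraMap (RatFunc K) E).injective p
  obtain ⟨y, hy⟩ := hind.exists_isArtinSchreierExtension p E
  have := hy.finite
  have := hy.galois
  have hval {P : Place K (RatFunc K)} (hP : P.IsRational) (i : Fin m) :
      P.ring.valuation (f i) < 1 := valuation_artinSchreierFun_lt_one hp.out.ne_zero hP i
  refine ⟨E, inferInstance, inferInstance, inferInstance, inferInstance, inferInstance,
    inferInstance, hy.finrank_eq, ?_, ?_, fun P hP => ?_⟩
  · obtain ⟨P, hP⟩ := exists_isRational K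
    exact hy.isFullConstantField (hval hP) (fun t ht => hP.exists_sub_algebraMap_lt_one ht)
      P.algebraMap_mem
  -- The index `0`, available since `1 ≤ m`, has numerator `s`, which is prime to `D`.
  · refine isWildlyRamifiedExtension_of_pow_sub_eq (separable_poleDivisorPoly K p m).squarefree
      ?_ ?_ (hy.root ⟨0, hm⟩)
    · intro hu
      have := natDegree_eq_zero_of_isUnit hu
      rw [natDegree_poleDivisorPoly] at this
      exact (Nat.mul_pos (Nat.succ_pos _) Nat.card_pos).ne' this
    · rw [pow_zero, one_mul]
      exact isCoprime_vanishingPoly_poleDivisorPoly K _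
  · exact P.splitsCompletely_of_ncard ((hy.ncard_comap_eq (hval hP)).trans hy.finrank_eq.symm)

end MainTheorem
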